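/- A multi-valued function $F : X \Rightarrow Y$ between metrizable spaces assigns to every $x \in X$ a nonempty set $F(x) \subseteq Y$; its graph is $\{(x,y) \in X \times Y : y \in F(x)\}$. It is continuous at $x$ if there is $y \in F(x)$ such that for every neighbourhood $V$ of $y$ there is a neighbourhood $U$ of $x$ with $F(x') \cap V \neq \emptyset$ for all $x' \in U$. Let $\mathcal{C} = 2^{\omega}$ be the Cantor space and $\mathcal{N} = \omega^{\omega}$ the Baire space. Let $\omega^{\star}$ be the set of finite sequences of natural numbers, let $\mathrm{Tr} \subseteq 2^{\omega^{\star}}$ be the space of nonempty trees on $\omega$ (the nonempty subsets of $\omega^{\star}$ closed under initial segments, identified with their characteristic functions, with the topology induced by the product topology), and let $\mathrm{IF} \subseteq \mathrm{Tr}$ be the set of ill-founded trees, i.e. of trees with an infinite branch. For a bijection $c : \omega \to \omega^{\star}$ let $e_c : \mathrm{Tr} \to \mathcal{C}$ be the embedding with $e_c(T)(n) = 1$ if and only if $c(n) \in T$. (a) There is a multi-valued function $F : \mathrm{Tr} \Rightarrow \mathcal{N}$ such that $F(T)$ is closed for all $T$, the graph of $F$ is a $\Sigma^0_2$ (hence Borel)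 subset of $\mathrm{Tr} \times \mathcal{N}$, and the set of points of continuity of $F$ is exactly $\mathrm{IF}$, which is analytic and not Borel. Moreover, for every bijection $c : \omega \to \omega^{\star}$ there is a multi-valued function $F : \mathcal{C} \Rightarrow \mathcal{N}$ such that $F(x)$ is closed for all $x \in \mathcal{C}$, the graph of $F$ is a $\Sigma^0_2$ (hence Borel) subset of $\mathcal{C} \times \mathcal{N}$, and the set of points of continuity of $F$ is exactly $e_c[\mathrm{IF}] \cup (\mathcal{C} \setminus e_c[\mathrm{Tr}])$ and is analytic and not Borel. (b) There is a multi-valued function $F : [0,1] \Rightarrow [0,1]$ whose graph is a Borel subset of $[0,1] \times [0,1]$ and whose set of points of continuity is analytic and not Borel. -/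

import Mathlib

open Set Filter Topology

/-- A multi-valued function `F : X ⇒ Y`: it assigns to every point of `X` a nonempty subset
of `Y` (all multi-valued functions are total). -/
structure MultiFun (X Y : Type*) where
  /-- The set of values at a point. -/
  val : X → Set Y
  nonempty : ∀ x, (val x).Nonempty

namespace MultiFun

/-- The graph of a multi-valued function, as a subset of `X × Y`. -/
def graph {X Y : Type*} (F : MultiFun X Y) : Set (X × Y) := {q | q.2 ∈ F.val q.1}

/-- `F` is continuous at `x`: for some `y ∈ F x`, every neighbourhood of `y` meets `F x'` for
all `x'` close enough to `x`. The ε-δ form for arbitrary metrics that induce the topologies is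
`MultiFun.continuousAt_iff` below. -/
def ContinuousAt {X Y : Type*} [TopologicalSpace X] [TopologicalSpace Y]
    (F : MultiFun X Y) (x : X) : Prop :=
  ∃ y ∈ F.val x, ∀ V ∈ 𝓝 y, ∃ U ∈ 𝓝 x, ∀ x' ∈ U, ∃ y' ∈ F.val x', y' ∈ V

/-- The set of points of continuity of `F`. -/
def continuityPoints {X Y : Type*} [TopologicalSpace X] [TopologicalSpace Y]
    (F : MultiFun X Y) : Set X := {x | F.ContinuousAt x}

/-- In metric spaces `MultiFun.ContinuousAt` is the usual ε-δ notion. -/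
theorem continuousAt_iff {X Y : Type*} [PseudoMetricSpace X] [PseudoMetricSpace Y]
    (F : MultiFun X Y) (x : X) :
    F.ContinuousAt x ↔ ∃ y ∈ F.val x, ∀ ε > 0, ∃ δ > 0, ∀ x' ∈ Metric.ball x δ,
      ∃ y' ∈ F.val x', dist y y' < ε := by
  constructor
  · rintro ⟨y, hy, h⟩
    refine ⟨y, hy, fun ε hε => ?_⟩
    obtain ⟨U, hU, h'⟩ := h _ (Metric.ball_mem_nhds y hε)
    obtain ⟨δ, hδ, hs⟩ := Metric.mem_nhds_iff.1 hU
    refine ⟨δ, hδ, fun x' hx' => ?_⟩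
    obtain ⟨y', hy', hV⟩ := h' x' (hs hx')
    exact ⟨y', hy', by rw [dist_comm]; exact hV⟩
  · rintro ⟨y, hy, h⟩
    refine ⟨y, hy, fun V hV => ?_⟩
    obtain ⟨ε, hε, hs⟩ := Metric.mem_nhds_iff.1 hV
    obtain ⟨δ, hδ, h'⟩ := h ε hε
    refine ⟨_, Metric.ball_mem_nhds x hδ, fun x' hx' => ?_⟩
    obtain ⟨y', hy', hd⟩ := h' x' hx'
    exact ⟨y', hy', hs (by rw [Metric.mem_ball, dist_comm]; exact hd)⟩

end MultiFun

/-- `Σ⁰₂` sets, i.e. countable unions of closed sets. -/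
def IsSigmaTwo {X : Type*} [TopologicalSpace X] (A : Set X) : Prop :=
  ∃ C : ℕ → Set X, (∀ n, IsClosed (C n)) ∧ A = ⋃ n, C n

/-- Borel sets of a topological space. -/
def IsBorelSet {X : Type*} [TopologicalSpace X] (A : Set X) : Prop :=
  @MeasurableSet X (borel X) A

/-- The Baire space, with the product topology. -/
abbrev BaireSpaceNat : Type := ℕ → ℕ

/-- The Cantor space, with the product topology. -/
abbrev CantorSpaceBool : Type := ℕ → Bool

/-- The space of nonempty trees on `ℕ`, i.e. of sets of finite sequences of naturals that
contain the empty sequence and are closed under initial segments. A tree is given by its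
characteristic function, and the topology is the one induced from the product space
`2 ^ (List ℕ)`. -/
abbrev TreeSpace : Type :=
  {χ : List ℕ → Bool // χ [] = true ∧ ∀ u v : List ℕ, u <+: v → χ v = true → χ u = true}

/-- The ill-founded trees: those with an infinite branch `α`, that is,
`(α 0, …, α (n - 1)) ∈ T` for all `n`. -/
def illFounded : Set TreeSpace :=
  {T | ∃ α : ℕ → ℕ, ∀ n : ℕ, T.1 ((List.range n).map α) = true}

/-- The code of a tree in the Cantor space, with respect to an enumeration `c` of the finite
sequences: its `n`-th digit tells whether `c n` is a node. -/
def treeCode (c : ℕ ≃ List ℕ) (T : TreeSpace) : CantorSpaceBool := fun n => T.1 (c n)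

/-! A value of `branchFun` at `T` is either an infinite branch of `T` or a node of `T`, an end
marker 0, and a value of `levelWitness`, which is continuous nowhere. If `T` has a branch, nearby
trees contain long initial segments of it, and these nodes, ended by any witness, approximate the
branch: `branchFun` is continuous at `T`. If `T` is well-founded, every value carries an end marker,
and continuity there would pass to the witness behind it. All conditions are closed, so the graph is
even closed.

That `illFounded` is not Borel is a diagonal argument over closed sets coded by points of the Cantor
space. The other two spaces are reached by closed embeddings of `TreeSpace`: with the full set as
value off the range, exactly the open complement of the range is added to the points of continuity.
-/

theorem continuous_comp_map_range {X A Z : Type*} [TopologicalSpace X] [TopologicalSpace A]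
    [DiscreteTopology A] [TopologicalSpace Z] (f : X → List A → Z)
    (hf : ∀ l, Continuous fun x => f x l) (n : ℕ) :
    Continuous fun p : X × (ℕ → A) => f p.1 ((List.range n).map p.2) := by
  have h : Continuous fun q : X × (Fin n → A) => f q.1 (List.ofFn q.2) :=
    by
    rw [continuous_prod_of_discrete_right]
    exact fun b => hf (List.ofFn b)
  have h2 : Continuous fun p : X × (ℕ → A) => (p.1, fun i : Fin n => p.2 i) := by fun_prop
  convert h.comp h2 using 2 with p
  simp only [Function.comp]
  congr 1
  apply List.ext_getElem <;> simp

theorem exists_forall_eq_imp_mem_of_mem_nhds {A : Type*} [TopologicalSpace A]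
    [DiscreteTopology A] {y : ℕ → A} {V : Set (ℕ → A)} (hV : V ∈ 𝓝 y) :
    ∃ n, ∀ z : ℕ → A, (∀ i < n, z i = y i) → z ∈ V := by
  obtain ⟨_, ⟨x, n, rfl⟩, hy, hs⟩ :=
    (PiNat.isTopologicalBasis_cylinders (fun _ : ℕ => A)).mem_nhds_iff.1 hV
  refine ⟨n, fun z hz => hs fun i hi => ?_⟩
  rw [hz i hi, hy i hi]

theorem map_range_eq_map_range_iff {A : Type*} {a b : ℕ → A} {n : ℕ} :
    (List.range n).map a = (List.range n).map b ↔ ∀ i < n, a i = b i := by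
  simp [List.map_inj_left]

theorem isClosed_setOf_isTree : IsClosed {χ : List ℕ → Bool |
    χ [] = true ∧ ∀ u v : List ℕ, u <+: v → χ v = true → χ u = true} := by
  have h (l : List ℕ) : IsClopen {χ : List ℕ → Bool | χ l = true} :=
    (isClopen_discrete {true}).preimage (continuous_apply l)
  simp only [ofPred_and, ofPred_forall]
  refine (h []).isClosed.inter (isClosed_iInter fun u => isClosed_iInter fun v =>
    isClosed_iInter fun _ => isClosed_imp (h v).isOpen (h u).isClosed)

instance polishSpace_pi_bool (ι : Type*) [Countable ι] : PolishSpace (ι → Bool) :=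
  haveI : SecondCountableTopology Bool := Finite.toSecondCountableTopology
  inferInstance

instance : CompactSpace TreeSpace :=
  isCompact_iff_compactSpace.1 isClosed_setOf_isTree.isCompact

instance : PolishSpace TreeSpace := isClosed_setOf_isTree.polishSpace

theorem continuous_treeSpace_apply (l : List ℕ) : Continuous fun T : TreeSpace => T.1 l :=
  (continuous_apply l).comp continuous_subtype_val

theorem isClopen_mem_tree (l : List ℕ) : IsClopen {T : TreeSpace | T.1 l = true} :=
  (isClopen_discrete {true}).preimage (continuous_treeSpace_apply l)

theorem isClosed_setOf_branch :
    IsClosed {p : TreeSpace × (ℕ → ℕ) | ∀ n, p.1.1 ((List.range n).map p.2) = true} := by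
  rw [ofPred_forall]
  exact isClosed_iInter fun n => (isClosed_discrete {true}).preimage
    (continuous_comp_map_range (fun (T : TreeSpace) l => T.1 l) continuous_treeSpace_apply n)

theorem analyticSet_illFounded : MeasureTheory.AnalyticSet illFounded := by
  convert isClosed_setOf_branch.analyticSet.image_of_continuous continuous_fst using 1
  ext T
  simp [illFounded]

/-! ### The ill-founded trees are not Borel -/

section NotBorel

/-- The tree of the `s` such that `x` contains the codes of all the pairs of proper initial
segments of the same length of `x` and `s`. -/
noncomputable def sectionTree (x : ℕ → Bool) : TreeSpace :=
  ⟨fun s => decide (∀ k < s.length,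
      x (Encodable.encode ((List.range k).map x, s.take k)) = true), by
    refine ⟨by simp, fun u v huv hv => ?_⟩
    simp only [decide_eq_true_eq] at hv ⊢
    intro k hk
    rw [← hv k (hk.trans_le huv.length_le)]
    congr 3
    obtain ⟨w, rfl⟩ := huv
    rw [List.take_append_of_le_length hk.le]⟩

theorem sectionTree_apply {x : ℕ → Bool} {s : List ℕ} : (sectionTree x).1 s = true ↔
    ∀ k < s.length, x (Encodable.encode ((List.range k).map x, s.take k)) = true :=
  decide_eq_true_iff

theorem continuous_sectionTree : Continuous sectionTree := by
  refine Continuous.subtype_mk (continuous_pi fun s => ?_) _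
  rw [continuous_bool_rng true]
  have : (fun x : ℕ → Bool => decide (∀ k < s.length,
      x (Encodable.encode ((List.range k).map x, s.take k)) = true)) ⁻¹' {true} =
      ⋂ k ∈ Finset.range s.length,
        {x | x (Encodable.encode ((List.range k).map x, s.take k)) = true} := by
    ext x
    rw [mem_preimage, mem_singleton_iff, decide_eq_true_iff]
    simp only [Finset.mem_range, mem_iInter, mem_ofPred_eq]
  rw [this]
  refine isClopen_biInter_finset fun k _ => (isClopen_discrete {true}).preimage ?_
  exact (continuous_comp_map_range
    (fun (x : ℕ → Bool) l => x (Encodable.encode (l, s.take k)))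
    (fun l => continuous_apply _) k).comp (continuous_id.prodMk continuous_id)

theorem sectionTree_mem_illFounded {x : ℕ → Bool} : sectionTree x ∈ illFounded ↔
    ∃ b : ℕ → ℕ, ∀ k,
      x (Encodable.encode ((List.range k).map x, (List.range k).map b)) = true := by
  refine exists_congr fun b => ⟨fun h k => ?_, fun h n => sectionTree_apply.2 fun k hk => ?_⟩
  · have := sectionTree_apply.1 (h (k + 1)) k (by simp)
    rwa [← List.map_take, List.take_range, min_eq_left k.le_succ] at this
  · simp only [List.length_map, List.length_range] at hk
    rw [← List.map_take, List.take_range, min_eq_left hk.le]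
    exact h k

/-- A diagonal argument: no analytic set is the complement of the set of all `x` whose section
tree is ill-founded. -/
theorem not_analyticSet_compl_preimage_illFounded :
    ¬ MeasureTheory.AnalyticSet (sectionTree ⁻¹' illFounded)ᶜ := by
  intro h
  rw [MeasureTheory.AnalyticSet] at h
  obtain h | ⟨f, hf, hr⟩ := h
  · have : (fun _ => false) ∈ (sectionTree ⁻¹' illFounded)ᶜ := by
      simp [sectionTree_mem_illFounded]
    rw [h] at this
    exact this
  classical
  -- `x` codes the closed set of all pairs `(f b, b)`, so its section at `x` is nonempty iff `x` is
  -- in the range of `f`, the alleged complement.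
  let x : ℕ → Bool := fun m => decide (∃ k, ∃ b : ℕ → ℕ,
    m = Encodable.encode ((List.range k).map (f b), (List.range k).map b))
  have hx : sectionTree x ∈ illFounded ↔ x ∈ range f := by
    rw [sectionTree_mem_illFounded]
    refine exists_congr fun b => ⟨fun h => ?_, ?_⟩
    · funext i
      have hi : {b' | f b' i = f b i} ∈ 𝓝 b :=
        ((isOpen_discrete {f b i}).preimage ((continuous_apply i).comp hf)).mem_nhds rfl
      obtain ⟨n, hn⟩ := exists_forall_eq_imp_mem_of_mem_nhds hi
      -- Length `n` lets continuity of `f` fix its value at `i`; length `i + 1` makes the segment of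
      -- `x` include the entry `i`.
      obtain ⟨k, b', hb'⟩ := decide_eq_true_iff.1 (h (max n (i + 1)))
      rw [Encodable.encode_inj, Prod.mk.injEq] at hb'
      obtain rfl : max n (i + 1) = k := by simpa using congrArg List.length hb'.1
      rw [map_range_eq_map_range_iff, map_range_eq_map_range_iff] at hb'
      rw [hb'.1 i (by omega)]
      exact (hn b' fun j hj => (hb'.2 j (by omega)).symm).symm
    · rintro h k
      simp only [x, decide_eq_true_eq]
      exact ⟨k, b, by rw [h]⟩
  rw [hr] at hx
  simp at hx

theorem not_isBorelSet_illFounded : ¬ IsBorelSet illFounded := by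
  intro h
  borelize TreeSpace
  borelize (ℕ → Bool)
  exact not_analyticSet_compl_preimage_illFounded
    ((continuous_sectionTree.measurable h).compl.analyticSet)

end NotBorel

/-! ### Transport along embeddings -/

namespace MultiFun

variable {X Y Z W : Type*}

theorem continuousAt_iff_eventually [TopologicalSpace X] [TopologicalSpace Y]
    {F : MultiFun X Y} {x : X} : F.ContinuousAt x ↔
      ∃ y ∈ F.val x, ∀ V ∈ 𝓝 y, ∀ᶠ x' in 𝓝 x, (F.val x' ∩ V).Nonempty := by
  refine exists_congr fun y => and_congr_right fun _ => forall₂_congr fun V _ => ?_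
  rw [eventually_iff_exists_mem]
  rfl

theorem isClosed_val [TopologicalSpace X] [TopologicalSpace Y] {F : MultiFun X Y}
    (h : IsClosed F.graph) (x : X) : IsClosed (F.val x) :=
  h.preimage (Continuous.prodMk_right x)

/-- Transport `F` along `e` and `i`, and let it take all values outside of the range of `e`. -/
def extend [Nonempty W] (F : MultiFun X Y) (e : X → Z) (i : Y → W) : MultiFun Z W where
  val z := {w | z ∈ range e → ∃ x, e x = z ∧ w ∈ i '' F.val x}
  nonempty z := by
    by_cases hz : z ∈ range e
    · obtain ⟨x, rfl⟩ := hz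
      obtain ⟨y, hy⟩ := F.nonempty x
      exact ⟨i y, fun _ => ⟨x, rfl, y, hy, rfl⟩⟩
    · exact ⟨Classical.arbitrary W, fun h => (hz h).elim⟩

section extend

variable [Nonempty W] (F : MultiFun X Y) {e : X → Z} {i : Y → W}

theorem extend_val_apply (he : Function.Injective e) (x : X) :
    (F.extend e i).val (e x) = i '' F.val x := by
  ext w
  exact ⟨fun h => let ⟨x', hx', hw⟩ := h ⟨x, rfl⟩; he hx' ▸ hw, fun h _ => ⟨x, rfl, h⟩⟩

theorem extend_val_of_notMem {z : Z} (hz : z ∉ range e) : (F.extend e i).val z = univ :=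
  eq_univ_of_forall fun _ h => (hz h).elim

theorem graph_extend : (F.extend e i).graph =
    Prod.map e i '' F.graph ∪ Prod.fst ⁻¹' (range e)ᶜ := by
  ext ⟨z, w⟩
  simp only [graph, extend, mem_ofPred_eq, mem_union, mem_image, Prod.exists, Prod.map_apply,
    Prod.mk.injEq, mem_preimage, mem_compl_iff]
  constructor
  · intro h
    by_cases hz : z ∈ range e
    · obtain ⟨x, hx, y, hy, hw⟩ := h hz
      exact .inl ⟨x, y, hy, hx, hw⟩
    · exact .inr hz
  · rintro (⟨x, y, hy, hx, hw⟩ | hz) h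
    · exact ⟨x, hx, y, hy, hw⟩
    · exact (hz h).elim

variable [TopologicalSpace X] [TopologicalSpace Y] [TopologicalSpace Z] [TopologicalSpace W]

theorem continuityPoints_extend (he : IsClosedEmbedding e) (hi : IsEmbedding i) :
    (F.extend e i).continuityPoints = e '' F.continuityPoints ∪ (range e)ᶜ := by
  ext z
  by_cases hz : z ∈ range e
  · obtain ⟨x, rfl⟩ := hz
    have : e x ∈ e '' F.continuityPoints ∪ (range e)ᶜ ↔ F.ContinuousAt x := by
      simp [he.injective.eq_iff, continuityPoints]
    rw [this, continuityPoints, mem_ofPred_eq, continuousAt_iff_eventually,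
      continuousAt_iff_eventually, extend_val_apply F he.injective, exists_mem_image]
    refine exists_congr fun y => and_congr_right fun hy => ⟨fun h V hV => ?_, fun h V hV => ?_⟩
    · rw [hi.nhds_eq_comap] at hV
      obtain ⟨V', hV', hV⟩ := hV
      filter_upwards [he.continuous.continuousAt.eventually (h V' hV')] with x' hx'
      rw [extend_val_apply F he.injective] at hx'
      obtain ⟨_, ⟨y', hy', rfl⟩, hw⟩ := hx'
      exact ⟨y', hy', hV hw⟩
    · have h' := h _ (hi.continuous.continuousAt hV)
      rw [he.isInducing.nhds_eq_comap, eventually_comap] at h'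
      filter_upwards [h'] with z hz
      by_cases hr : z ∈ range e
      · obtain ⟨x', rfl⟩ := hr
        obtain ⟨y', hy', hw⟩ := hz x' rfl
        rw [extend_val_apply F he.injective]
        exact ⟨i y', mem_image_of_mem i hy', hw⟩
      · rw [extend_val_of_notMem F hr, univ_inter]
        exact ⟨i y, mem_of_mem_nhds hV⟩
  · simp only [mem_union, mem_compl_iff, hz, not_false_eq_true, or_true, iff_true]
    rw [continuityPoints, mem_ofPred_eq, continuousAt_iff_eventually]
    refine ⟨Classical.arbitrary W, by simp [extend_val_of_notMem F hz], fun V hV => ?_⟩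
    filter_upwards [he.isClosed_range.isOpen_compl.mem_nhds hz] with z' hz'
    rw [extend_val_of_notMem F hz', univ_inter]
    exact ⟨_, mem_of_mem_nhds hV⟩

theorem analyticSet_continuityPoints_extend [PolishSpace Z] (he : IsClosedEmbedding e)
    (hi : IsEmbedding i) (hF : MeasureTheory.AnalyticSet F.continuityPoints) :
    MeasureTheory.AnalyticSet (F.extend e i).continuityPoints := by
  rw [continuityPoints_extend F he hi, union_eq_iUnion]
  refine MeasureTheory.AnalyticSet.iUnion fun b => ?_
  cases b
  · simpa using he.isClosed_range.isOpen_compl.analyticSet_image continuous_id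
  · exact hF.image_of_continuous he.continuous

theorem not_isBorelSet_continuityPoints_extend (he : IsClosedEmbedding e) (hi : IsEmbedding i)
    (hF : ¬ IsBorelSet F.continuityPoints) :
    ¬ IsBorelSet (F.extend e i).continuityPoints := by
  intro h
  borelize X
  borelize Z
  apply hF
  have := he.continuous.measurable h
  rwa [continuityPoints_extend F he hi, preimage_union, preimage_compl, preimage_range,
    compl_univ, union_empty, preimage_image_eq _ he.injective] at this

/-- By Lusin–Souslin, injective continuous images of Borel sets are Borel; so `i` need not have
closed range, as for the Baire space in `[0,1]`. -/
theorem isBorelSet_graph_extend [PolishSpace X] [PolishSpace Y] [PolishSpace Z] [PolishSpace W]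
    (he : IsClosedEmbedding e) (hi : IsEmbedding i) (hF : IsBorelSet F.graph) :
    IsBorelSet (F.extend e i).graph := by
  borelize (X × Y)
  borelize (Z × W)
  rw [graph_extend]
  have h := MeasurableSet.image_of_continuousOn_injOn (s := F.graph) hF
    (he.continuous.prodMap hi.continuous).continuousOn
    (he.injective.prodMap hi.injective).injOn
  exact h.union (he.isClosed_range.isOpen_compl.preimage continuous_fst).measurableSet

/-- The graph is the union of a closed set and an open set, and open sets in metrizable spaces are
countable unions of closed sets. -/
theorem isSigmaTwo_graph_extend [TopologicalSpace.MetrizableSpace (Z × W)]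
    (he : IsClosedEmbedding e) (hi : IsClosedEmbedding i) (hF : IsClosed F.graph) :
    IsSigmaTwo (F.extend e i).graph := by
  let := TopologicalSpace.metrizableSpaceMetric (Z × W)
  obtain ⟨C, hC, -, hU, -⟩ :=
    (he.isClosed_range.isOpen_compl.preimage (continuous_fst (Y := W))).exists_iUnion_isClosed
  refine ⟨fun n => Prod.map e i '' F.graph ∪ C n, fun n =>
    ((he.prodMap hi).isClosedMap _ hF).union (hC n), ?_⟩
  rw [graph_extend, ← union_iUnion, hU]

end extend

end MultiFun

theorem IsClosed.isSigmaTwo {X : Type*} [TopologicalSpace X] {A : Set X} (h : IsClosed A) :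
    IsSigmaTwo A :=
  ⟨fun _ => A, fun _ => h, (iUnion_const A).symm⟩

theorem IsSigmaTwo.isBorelSet {X : Type*} [TopologicalSpace X] {A : Set X} (h : IsSigmaTwo A) :
    IsBorelSet A := by
  borelize X
  obtain ⟨C, hC, rfl⟩ := h
  exact MeasurableSet.iUnion fun n => (hC n).measurableSet

theorem isClosedEmbedding_treeCode (c : ℕ ≃ List ℕ) : IsClosedEmbedding (treeCode c) := by
  refine Continuous.isClosedEmbedding
    (continuous_pi fun n => continuous_treeSpace_apply (c n)) fun S T h => ?_
  refine Subtype.ext (funext fun s => ?_)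
  have := congrFun h (c.symm s)
  simpa [treeCode] using this

theorem exists_isClosedEmbedding_cantor_unitInterval :
    ∃ f : CantorSpaceBool → unitInterval, IsClosedEmbedding f := by
  refine ⟨fun x => inclusion cantorSet_subset_unitInterval (cantorSetHomeomorphNatToBool.symm x),
    Continuous.isClosedEmbedding ?_ ?_⟩
  · exact (continuous_inclusion cantorSet_subset_unitInterval).comp (Homeomorph.continuous _)
  · exact (inclusion_injective cantorSet_subset_unitInterval).comp (Homeomorph.injective _)

theorem exists_isEmbedding_baire_cantor :
    ∃ f : BaireSpaceNat → CantorSpaceBool, IsEmbedding f := by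
  -- The characteristic function of the graph of `y`.
  let f : BaireSpaceNat → CantorSpaceBool := fun y m => decide (y m.unpair.1 = m.unpair.2)
  have hf : Continuous f := continuous_pi fun m =>
    (continuous_of_discreteTopology (f := fun k : ℕ => decide (k = m.unpair.2))).comp
      (continuous_apply m.unpair.1)
  have key (y : BaireSpaceNat) (n k : ℕ) : f y (Nat.pair n k) = true ↔ y n = k := by
    simp [f]
  refine ⟨f, ?_, fun y z h => funext fun n => ?_⟩
  · rw [isInducing_iff_nhds]
    refine fun y => le_antisymm hf.continuousAt.le_comap ?_
    rw [← tendsto_id', tendsto_pi_nhds]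
    intro n
    rw [nhds_discrete ℕ, tendsto_pure]
    have h : {x : CantorSpaceBool | x (Nat.pair n (y n)) = true} ∈ 𝓝 (f y) :=
      (continuous_apply (Nat.pair n (y n))).continuousAt.preimage_mem_nhds
        ((isOpen_discrete {true}).mem_nhds ((key y n (y n)).2 rfl))
    filter_upwards [preimage_mem_comap h] with z hz
    exact (key z n (y n)).1 hz
  · exact ((key z n (y n)).1 (h ▸ (key y n (y n)).2 rfl)).symm

theorem setOf_apply_eq_mem_nhds {A : Type*} [TopologicalSpace A] [DiscreteTopology A]
    (y : ℕ → A) (i : ℕ) : {z | z i = y i} ∈ 𝓝 y :=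
  (continuous_apply i).continuousAt.preimage_mem_nhds ((isOpen_discrete {y i}).mem_nhds rfl)

/-! ### A closed-graph function continuous nowhere -/

/-- Witnesses that a tree has finitely many, or infinitely many, nodes of length one. -/
def levelWitness : MultiFun TreeSpace BaireSpaceNat where
  val T := {h | (h 0 = 0 ∧ ∀ m, h 1 ≤ m → T.1 [m] = false) ∨
    (h 0 ≠ 0 ∧ ∀ n, n ≤ h (n + 1) ∧ T.1 [h (n + 1)] = true)}
  nonempty T := by
    by_cases hT : ∃ k, ∀ m, k ≤ m → T.1 [m] = false
    · obtain ⟨k, hk⟩ := hT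
      exact ⟨fun n => n.casesOn 0 fun _ => k, .inl ⟨rfl, hk⟩⟩
    · push Not at hT
      choose g hg hg' using hT
      exact ⟨fun n => n.casesOn 1 g, .inr ⟨one_ne_zero, fun n => ⟨hg n, by simpa using hg' n⟩⟩⟩

/-- The flag `h 0` separates the two cases by a clopen condition, and in each case the other entries
replace the quantifier over nodes by closed conditions. -/
theorem isClosed_graph_levelWitness : IsClosed levelWitness.graph := by
  have h2 (k : ℕ) : Continuous fun p : TreeSpace × BaireSpaceNat => p.2 k := by fun_prop
  have ht : Continuous fun p : TreeSpace × ℕ => p.1.1 [p.2] := by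
    rw [continuous_prod_of_discrete_right]
    exact fun m => continuous_treeSpace_apply [m]
  have hk (s : Set ℕ) (k : ℕ) : IsClopen {p : TreeSpace × BaireSpaceNat | p.2 k ∈ s} :=
    (isClopen_discrete s).preimage (h2 k)
  change IsClosed {p : TreeSpace × BaireSpaceNat |
    (p.2 0 = 0 ∧ ∀ m, p.2 1 ≤ m → p.1.1 [m] = false) ∨
    (p.2 0 ≠ 0 ∧ ∀ n, n ≤ p.2 (n + 1) ∧ p.1.1 [p.2 (n + 1)] = true)}
  simp only [ofPred_or, ofPred_and, ofPred_forall]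
  refine IsClosed.union (IsClosed.inter (hk {0} 0).isClosed (isClosed_iInter fun m => ?_))
    (IsClosed.inter (hk {0}ᶜ 0).isClosed (isClosed_iInter fun n =>
      IsClosed.inter (hk (Ici n) (n + 1)).isClosed ?_))
  · exact isClosed_imp (hk (Iic m) 1).isOpen ((isClosed_discrete {false}).preimage
      ((continuous_treeSpace_apply [m]).comp continuous_fst))
  · exact (isClosed_discrete {true}).preimage (ht.comp (continuous_fst.prodMk (h2 (n + 1))))

/-- Remove all nodes with first entry at least `k`. -/
def TreeSpace.trim (T : TreeSpace) (k : ℕ) : TreeSpace :=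
  ⟨fun s => T.1 s && decide (∀ m ∈ s.head?, m < k), by
    refine ⟨by simp [T.2.1], fun u v huv hv => ?_⟩
    simp only [Bool.and_eq_true, decide_eq_true_eq] at hv ⊢
    refine ⟨T.2.2 u v huv hv.1, fun m hm => hv.2 m ?_⟩
    obtain ⟨w, rfl⟩ := huv
    cases u <;> simp_all⟩

/-- Add all nodes of length one with entry at least `k`. -/
def TreeSpace.widen (T : TreeSpace) (k : ℕ) : TreeSpace :=
  ⟨fun s => T.1 s || decide (s.length = 1 ∧ ∀ m ∈ s.head?, k ≤ m), by
    refine ⟨by simp [T.2.1], fun u v huv hv => ?_⟩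
    simp only [Bool.or_eq_true, decide_eq_true_eq] at hv ⊢
    rcases hv with hv | ⟨hl, hv⟩
    · exact .inl (T.2.2 u v huv hv)
    · rcases u with _ | ⟨a, u⟩
      · exact .inl T.2.1
      · right
        obtain ⟨w, rfl⟩ := huv
        simp_all⟩

theorem tendsto_treeSpace {S : ℕ → TreeSpace} {T : TreeSpace}
    (h : ∀ s, ∀ᶠ k in atTop, (S k).1 s = T.1 s) : Tendsto S atTop (𝓝 T) := by
  rw [tendsto_subtype_rng, tendsto_pi_nhds]
  intro s
  rw [nhds_discrete, tendsto_pure]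
  exact h s

theorem TreeSpace.tendsto_trim (T : TreeSpace) : Tendsto T.trim atTop (𝓝 T) := by
  refine tendsto_treeSpace fun s => ?_
  filter_upwards [eventually_gt_atTop (s.headD 0)] with k hk
  cases s <;> simp_all [trim]

theorem TreeSpace.tendsto_widen (T : TreeSpace) : Tendsto T.widen atTop (𝓝 T) := by
  refine tendsto_treeSpace fun s => ?_
  filter_upwards [eventually_gt_atTop (s.headD 0)] with k hk
  cases s <;> simp_all [widen]

/-- Every tree is a limit of trees with finite first level and of trees with infinite first level,
which force opposite flags `h 0`. -/
theorem not_continuousAt_levelWitness (T : TreeSpace) : ¬ levelWitness.ContinuousAt T := by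
  rw [MultiFun.continuousAt_iff_eventually]
  rintro ⟨h, -, hc⟩
  have hev := hc {h' | h' 0 = h 0}
    (setOf_apply_eq_mem_nhds h 0)
  obtain ⟨k, h', hk, hk'⟩ := (T.tendsto_trim.eventually hev).exists
  obtain ⟨l, h'', hl, hl'⟩ := (T.tendsto_widen.eventually hev).exists
  have h0 : h' 0 = 0 := by
    rcases hk with hk | hk
    · exact hk.1
    · have := hk.2 k
      simp [TreeSpace.trim] at this
      omega
  have h1 : h'' 0 ≠ 0 := by
    rcases hl with hl | hl
    · have := hl.2 (max (h'' 1) l) (le_max_left _ _)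
      simp [TreeSpace.widen] at this
    · exact hl.1
  exact h1 (hl'.trans (hk'.symm.trans h0))

/-! ### The function continuous exactly at the ill-founded trees -/

/-- The values at `T` are the branches of `T`, shifted by one, and the nodes of `T`, shifted
by one and followed by zero and a witness for the size of the first level of `T`. -/
def branchFun : MultiFun TreeSpace BaireSpaceNat where
  val T := {y | ∀ n, (∀ i < n, y i ≠ 0) →
    T.1 ((List.range n).map fun i => y i - 1) = true ∧
    (y n = 0 → (fun k => y (n + 1 + k)) ∈ levelWitness.val T)}
  nonempty T := by
    obtain ⟨h, hh⟩ := levelWitness.nonempty T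
    refine ⟨fun n => n.casesOn 0 h, fun n hn => ?_⟩
    obtain rfl : n = 0 := by
      by_contra h0
      exact hn 0 (Nat.pos_of_ne_zero h0) rfl
    refine ⟨T.2.1, fun _ => ?_⟩
    convert hh using 2 with k
    rw [zero_add, add_comm]

theorem isClosed_graph_branchFun : IsClosed branchFun.graph := by
  have hz (n : ℕ) : IsClopen {p : TreeSpace × BaireSpaceNat | p.2 n = 0} :=
    (isClopen_discrete {0}).preimage ((continuous_apply n).comp continuous_snd)
  change IsClosed {p : TreeSpace × BaireSpaceNat | ∀ n, (∀ i < n, p.2 i ≠ 0) →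
    p.1.1 ((List.range n).map fun i => p.2 i - 1) = true ∧
    (p.2 n = 0 → (p.1, fun k => p.2 (n + 1 + k)) ∈ levelWitness.graph)}
  rw [ofPred_forall]
  refine isClosed_iInter fun n => isClosed_imp ?_ (IsClosed.inter ?_ (isClosed_imp (hz n).isOpen ?_))
  · have : {p : TreeSpace × BaireSpaceNat | ∀ i < n, p.2 i ≠ 0} =
        ⋂ i ∈ Finset.range n, {p | p.2 i = 0}ᶜ := by
      ext p
      simp
    rw [this]
    exact isOpen_biInter_finset fun i _ => (hz i).compl.isOpen
  · refine (isClosed_discrete {true}).preimage ((continuous_comp_map_range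
      (fun (T : TreeSpace) l => T.1 l) continuous_treeSpace_apply n).comp
      (f := fun p : TreeSpace × BaireSpaceNat => (p.1, fun i => p.2 i - 1)) ?_)
    refine continuous_fst.prodMk (continuous_pi fun i => ?_)
    exact (continuous_of_discreteTopology (f := fun k : ℕ => k - 1)).comp
      ((continuous_apply i).comp continuous_snd)
  · refine isClosed_graph_levelWitness.preimage
      (f := fun p : TreeSpace × BaireSpaceNat => (p.1, fun k => p.2 (n + 1 + k))) ?_
    fun_prop

theorem continuousAt_branchFun_of_illFounded {T : TreeSpace} (hT : T ∈ illFounded) :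
    branchFun.ContinuousAt T := by
  obtain ⟨a, ha⟩ := hT
  rw [MultiFun.continuousAt_iff_eventually]
  refine ⟨fun i => a i + 1, fun n _ => ⟨by simpa using ha n, by simp⟩, fun V hV => ?_⟩
  obtain ⟨N, hN⟩ := exists_forall_eq_imp_mem_of_mem_nhds hV
  filter_upwards [(isClopen_mem_tree _).isOpen.mem_nhds (ha N)] with S hS
  obtain ⟨h, hh⟩ := levelWitness.nonempty S
  -- The node of length `N` on the branch, the end marker, then a witness for `S` itself.
  let y : ℕ → ℕ := fun i => if i < N then a i + 1 else if i = N then 0 else h (i - (N + 1))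
  have hy (i : ℕ) (hi : i < N) : y i = a i + 1 := if_pos hi
  have hyN : y N = 0 := by simp [y]
  refine ⟨y, fun n hn => ?_, hN y hy⟩
  have hnN : n ≤ N := by
    by_contra hlt
    exact hn N (not_le.1 hlt) hyN
  constructor
  · have : ((List.range n).map fun i => y i - 1) = (List.range n).map a := by
      rw [map_range_eq_map_range_iff]
      intro i hi
      rw [hy i (hi.trans_le hnN), Nat.add_sub_cancel]
    rw [this]
    refine S.2.2 _ _ ?_ hS
    have : List.range n <+: List.range N := by
      rw [← min_eq_left hnN, ← List.take_range]
      exact List.take_prefix _ _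
    exact this.map a
  · intro hn0
    obtain rfl : n = N := by
      by_contra hne
      rw [hy n (by omega)] at hn0
      omega
    convert hh using 2 with k
    simp only [y]
    rw [if_neg (by omega), if_neg (by omega), Nat.add_sub_cancel_left]

theorem illFounded_of_continuousAt_branchFun {T : TreeSpace} (hT : branchFun.ContinuousAt T) :
    T ∈ illFounded := by
  classical
  rw [MultiFun.continuousAt_iff_eventually] at hT
  obtain ⟨y, hy, hc⟩ := hT
  by_cases hz : ∃ n, y n = 0
  · exfalso
    let n := Nat.find hz
    have hn : y n = 0 := Nat.find_spec hz
    have hlt (i : ℕ) (hi : i < n) : y i ≠ 0 := Nat.find_min hz hi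
    apply not_continuousAt_levelWitness T
    rw [MultiFun.continuousAt_iff_eventually]
    refine ⟨_, (hy n hlt).2 hn, fun V hV => ?_⟩
    have hs : Continuous fun z : ℕ → ℕ => fun k => z (n + 1 + k) := by fun_prop
    -- Agreement up to and including `n` puts the first zero of `z` at `n` too, so the tail of `z`
    -- is a witness for `S`.
    have hU : {z : ℕ → ℕ | ∀ i ∈ Finset.range (n + 1), z i = y i} ∈ 𝓝 y := by
      simp only [ofPred_forall]
      rw [Filter.biInter_finset_mem]
      exact fun i _ => setOf_apply_eq_mem_nhds y i
    filter_upwards [hc _ (inter_mem (hs.continuousAt.preimage_mem_nhds hV) hU)] with S hS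
    obtain ⟨z, hz, hzV, hzU⟩ := hS
    have hzU (i : ℕ) (hi : i ≤ n) : z i = y i := hzU i (by simp; omega)
    exact ⟨_, (hz n fun i hi => by rw [hzU i hi.le]; exact hlt i hi).2 (by rw [hzU n le_rfl, hn]),
      hzV⟩
  · exact ⟨fun i => y i - 1, fun n => (hy n fun i _ h => hz ⟨i, h⟩).1⟩

theorem continuityPoints_branchFun : branchFun.continuityPoints = illFounded :=
  ext fun _ => ⟨illFounded_of_continuousAt_branchFun, continuousAt_branchFun_of_illFounded⟩

theorem theorem2p9 :
    -- on the space of trees: the points of continuity are exactly the ill-founded trees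
    (∃ F : MultiFun TreeSpace BaireSpaceNat,
      (∀ T, IsClosed (F.val T)) ∧
      IsSigmaTwo F.graph ∧ IsBorelSet F.graph ∧
      F.continuityPoints = illFounded ∧
      MeasureTheory.AnalyticSet F.continuityPoints ∧
      ¬ IsBorelSet F.continuityPoints) ∧
    -- on the Cantor space, with the trees identified with their codes
    (∀ c : ℕ ≃ List ℕ, ∃ F : MultiFun CantorSpaceBool BaireSpaceNat,
      (∀ x, IsClosed (F.val x)) ∧
      IsSigmaTwo F.graph ∧ IsBorelSet F.graph ∧
      F.continuityPoints = treeCode c '' illFounded ∪ (range (treeCode c))ᶜ ∧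
      MeasureTheory.AnalyticSet F.continuityPoints ∧
      ¬ IsBorelSet F.continuityPoints) ∧
    -- on the unit interval
    (∃ F : MultiFun unitInterval unitInterval,
      IsBorelSet F.graph ∧
      MeasureTheory.AnalyticSet F.continuityPoints ∧
      ¬ IsBorelSet F.continuityPoints) := by
  have hB := isClosed_graph_branchFun
  have hA : MeasureTheory.AnalyticSet branchFun.continuityPoints :=
    continuityPoints_branchFun ▸ analyticSet_illFounded
  have hN : ¬ IsBorelSet branchFun.continuityPoints :=
    continuityPoints_branchFun ▸ not_isBorelSet_illFounded
  refine ⟨⟨branchFun, branchFun.isClosed_val hB, hB.isSigmaTwo, hB.isSigmaTwo.isBorelSet,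
    continuityPoints_branchFun, hA, hN⟩, fun c => ?_, ?_⟩
  · have he := isClosedEmbedding_treeCode c
    have hi : IsClosedEmbedding (id : BaireSpaceNat → BaireSpaceNat) := .id
    have hS := branchFun.isSigmaTwo_graph_extend he hi hB
    refine ⟨branchFun.extend (treeCode c) id, fun x => ?_, hS, hS.isBorelSet, ?_,
      branchFun.analyticSet_continuityPoints_extend he hi.isEmbedding hA,
      branchFun.not_isBorelSet_continuityPoints_extend he hi.isEmbedding hN⟩
    · by_cases hx : x ∈ range (treeCode c)
      · obtain ⟨T, rfl⟩ := hx
        rw [MultiFun.extend_val_apply _ he.injective, image_id]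
        exact branchFun.isClosed_val hB T
      · rw [MultiFun.extend_val_of_notMem _ hx]
        exact isClosed_univ
    · rw [MultiFun.continuityPoints_extend _ he hi.isEmbedding, continuityPoints_branchFun]
  · obtain ⟨f, hf⟩ := exists_isClosedEmbedding_cantor_unitInterval
    obtain ⟨g, hg⟩ := exists_isEmbedding_baire_cantor
    have he := hf.comp (isClosedEmbedding_treeCode (Denumerable.eqv (List ℕ)).symm)
    have hi := hf.isEmbedding.comp hg
    exact ⟨branchFun.extend _ _,
      branchFun.isBorelSet_graph_extend he hi hB.isSigmaTwo.isBorelSet,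
      branchFun.analyticSet_continuityPoints_extend he hi hA,
      branchFun.not_isBorelSet_continuityPoints_extend he hi hN⟩
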